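/- Let $n\ge 2$ be an integer. The graceful colouring of the complete graph $K_{n+1}$ on the vertex set $\{0,1,\dots,n\}$ gives the edge $ij$ the colour $|i-j|$. An edge-colouring of $K_{n+1}$ is called nice if it uses exactly $n$ colours and its colour classes have sizes $1,2,\dots,n$. For a nice colouring let $C_i$ be the colour class of size $i$, let $G_i$ be the subgraph of $K_{n+1}$ formed by the edges of $C_i$ and their endpoints, and let $V(G_i)$ be the set of vertices of $G_i$. A nice colouring is called beautiful if every $G_i$, $1\le i\le n$, is acyclic and there is a partition $\{V_1,V_2\}$ of the vertex set of $K_{n+1}$ with $|V_1|=\lfloor\frac{n+1}{2}\rfloor$ and $|V_2|=\lceil\frac{n+1}{2}\rceil$ such that: (i) the union of the classes $C_i$ with $i\equiv n \pmod 2$ is the edge set of the complete bipartite graph with parts $V_1$ and $V_2$; (ii) for every $i\equiv n\pmod 2$, $|V(G_i)\cap V_1|=\lfloor |V(G_i)|/2\rfloor$ and $|V(G_i)\cap V_2|=\lceil |V(G_i)|/2\rceil$; (iii) for every $i\not\equiv n\pmod 2$, exactly $\lfloor i/2\rfloor$ edges of $C_i$ have both ends in $V_1$ and exactly $\lceil i/2\rceil$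 edges of $C_i$ have both ends in $V_2$. Then the graceful colouring of $K_{n+1}$ is beautiful, and $K_{n+1}$ has at least $2^{\lfloor (n-1)/2\rfloor}$ distinct spanning trees that are heterochromatic, that is, whose edges have pairwise different colours in the graceful colouring. -/

import Mathlib

/-- The graceful colouring of the complete graph on `{0, 1, …, n}`: the edge `ij` gets the colour
`|i - j|`. -/
def gracefulColouring (n : ℕ) : SimpleGraph.TopEdgeLabeling (Fin (n + 1)) ℕ :=
  SimpleGraph.EdgeLabeling.mk (fun i j _ => ((i : ℤ) - (j : ℤ)).natAbs)
    (fun i j _ => by omega)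

namespace SimpleGraph.EdgeLabeling

/-- A subgraph `H` (given by its edges) of an edge-coloured graph is heterochromatic if distinct
edges of `H` have distinct colours. -/
def IsHeterochromatic {V K : Type*} {G : SimpleGraph V} (C : G.EdgeLabeling K)
    (H : SimpleGraph V) : Prop :=
  ∀ e f : G.edgeSet, e.1 ∈ H.edgeSet → f.1 ∈ H.edgeSet → C e = C f → e = f

/-- The heterochromatic spanning trees of an edge-coloured graph. -/
def heterochromaticSpanningTrees {V K : Type*} {G : SimpleGraph V} (C : G.EdgeLabeling K) :
    Set (SimpleGraph V) :=
  {T | T ≤ G ∧ T.IsTree ∧ C.IsHeterochromatic T}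

/-- The size of the colour class of `k`. -/
noncomputable def classSize {V K : Type*} {G : SimpleGraph V} (C : G.EdgeLabeling K) (k : K) : ℕ :=
  (C.labelGraph k).edgeSet.ncard

/-- A colouring of `K_{n+1}` is nice if it uses exactly `n` colours and the colour classes have
sizes `1, 2, …, n`. -/
def IsNice {n : ℕ} {K : Type*} (C : TopEdgeLabeling (Fin (n + 1)) K) : Prop :=
  Set.BijOn C.classSize (Set.range C) (Set.Icc 1 n)

/-- Beautiful colourings of `K_{n+1}`. For a nice colouring, a used colour `k` is determined by the
size `i = C.classSize k` of its class, so `C.labelGraph k` is the graph `G_i` spanned by the class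
`C_i` of size `i`, and its `support` is `V(G_i)`. -/
structure IsBeautiful {n : ℕ} {K : Type*} (C : TopEdgeLabeling (Fin (n + 1)) K) : Prop where
  nice : C.IsNice
  acyclic : ∀ k ∈ Set.range C, (C.labelGraph k).IsAcyclic
  exists_partition : ∃ V₁ V₂ : Set (Fin (n + 1)), IsCompl V₁ V₂ ∧
    V₁.ncard = (n + 1) / 2 ∧ V₂.ncard = (n + 2) / 2 ∧
    -- the classes `C_i` with `i ≡ n (mod 2)` form the complete bipartite graph on `V₁, V₂`
    (⨆ k ∈ {k ∈ Set.range C | C.classSize k ≡ n [MOD 2]}, C.labelGraph k) =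
      (⊤ : SimpleGraph (Fin (n + 1))).between V₁ V₂ ∧
    -- balance of the vertices of the classes with `i ≡ n (mod 2)`
    (∀ k ∈ Set.range C, C.classSize k ≡ n [MOD 2] →
      ((C.labelGraph k).support ∩ V₁).ncard = (C.labelGraph k).support.ncard / 2 ∧
      ((C.labelGraph k).support ∩ V₂).ncard = ((C.labelGraph k).support.ncard + 1) / 2) ∧
    -- balance of the edges of the classes with `i ≢ n (mod 2)`
    (∀ k ∈ Set.range C, ¬ C.classSize k ≡ n [MOD 2] →
      {e ∈ (C.labelGraph k).edgeSet | ∀ v ∈ e, v ∈ V₁}.ncard = C.classSize k / 2 ∧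
      {e ∈ (C.labelGraph k).edgeSet | ∀ v ∈ e, v ∈ V₂}.ncard = (C.classSize k + 1) / 2)

end SimpleGraph.EdgeLabeling

/-
With `V₁` the odd and `V₂` the even vertices, every condition on the partition counts odd and even
numbers: the class of colour `k` has `n + 1 - k` edges `{j, j + k}`, its vertices are those below
`n + 1 - k` together with those from `k` on, and an edge joins `V₁` to `V₂` exactly when its colour
is odd.

The trees are double stars with centres `0` and `n`. An inner vertex `v` gives the colour `v` if it
is attached to `0`, and `n - v` if it is attached to `n`. So if `v` and `n - v` are always attached
to the same centre, then sending `v` to its colour is an involution, whence the colours are pairwise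
different. The choice of a centre for each of the `n / 2` orbits of `v ↦ n - v` on the inner
vertices is free.
-/

open SimpleGraph

section FunctionalGraph

variable {V : Type*}

/-- The graph of a self-map: each vertex `v` is joined to its image `f v`. When `f` moves every
vertex but a root downwards, this is the rooted tree in which `f v` is the parent of `v`. -/
def functionalGraph (f : V → V) : SimpleGraph V :=
  fromRel fun v w => f v = w

namespace functionalGraph

variable {f : V → V}

theorem adj_iff {v w : V} : (functionalGraph f).Adj v w ↔ v ≠ w ∧ (f v = w ∨ f w = v) :=
  fromRel_adj _ _ _

theorem adj_apply {v : V} (hv : f v ≠ v) : (functionalGraph f).Adj v (f v) :=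
  adj_iff.2 ⟨hv.symm, Or.inl rfl⟩

theorem exists_of_mem_edgeSet {e : Sym2 V} (he : e ∈ (functionalGraph f).edgeSet) :
    ∃ v, v ≠ f v ∧ e = s(v, f v) := by
  induction e with | _ v w
  have hadj : (functionalGraph f).Adj v w := he
  obtain ⟨hne, rfl | rfl⟩ := adj_iff.1 hadj
  · exact ⟨v, hne, rfl⟩
  · exact ⟨w, hne.symm, Sym2.eq_swap⟩

variable {α : Type*} [LinearOrder α] {height : V → α}

-- Both neighbours of a highest vertex on a cycle would have to be its image.
theorem isAcyclic (hf : ∀ v, f v ≠ v → height (f v) < height v) :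
    (functionalGraph f).IsAcyclic := by
  classical
  have eq_of_adj_of_le {v w : V} (hvw : (functionalGraph f).Adj v w)
      (hle : height w ≤ height v) : w = f v := by
    obtain ⟨hne, rfl | rfl⟩ := adj_iff.1 hvw
    · rfl
    · exact absurd (hf w hne) hle.not_gt
  intro v c hc
  obtain ⟨x, hx, hmax⟩ := c.support.toFinset.exists_max_image height ⟨v, by simp⟩
  simp only [List.mem_toFinset] at hx hmax
  have hcycle := hc.rotate hx
  have hle (i : ℕ) : height ((c.rotate x hx).getVert i) ≤ height x :=
    hmax _ ((c.mem_support_rotate_iff x hx).1 (Walk.getVert_mem_support _ _))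
  refine hcycle.snd_ne_penultimate ?_
  rw [eq_of_adj_of_le (Walk.adj_snd hcycle.not_nil) (hle _),
    eq_of_adj_of_le (Walk.adj_penultimate hcycle.not_nil).symm (hle _)]

theorem isTree [WellFoundedLT α] (hf : ∀ v, f v ≠ v → height (f v) < height v)
    {root : V} (hroot : ∀ v, f v = v → v = root) : (functionalGraph f).IsTree := by
  refine ⟨?_, isAcyclic hf⟩
  have reachable_root (v : V) : (functionalGraph f).Reachable v root := by
    induction v using (InvImage.wf height wellFounded_lt).induction with
    | _ v ih =>
      by_cases hv : f v = v
      · rw [hroot v hv]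
      · exact (adj_apply hv).reachable.trans (ih (f v) (hf v hv))
  exact (connected_iff_exists_forall_reachable _).2 ⟨root, fun v => (reachable_root v).symm⟩

theorem isHeterochromatic {K : Type*} {C : TopEdgeLabeling V K}
    (hC : ∀ v w (hv : v ≠ f v) (hw : w ≠ f w), C.get v (f v) hv = C.get w (f w) hw → v = w) :
    C.IsHeterochromatic (functionalGraph f) := by
  rintro ⟨e, he⟩ ⟨e', he'⟩ hef hef' heq
  obtain ⟨v, hv, rfl⟩ := exists_of_mem_edgeSet hef
  obtain ⟨w, hw, rfl⟩ := exists_of_mem_edgeSet hef'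
  obtain rfl := hC v w hv hw heq
  rfl

end functionalGraph

end FunctionalGraph

section Count

theorem count_odd (m : ℕ) : Nat.count Odd m = m / 2 := by
  induction m with
  | zero => rfl
  | succ m ih => grind

theorem count_even (m : ℕ) : Nat.count Even m = (m + 1) / 2 := by
  induction m with
  | zero => rfl
  | succ m ih => grind

variable (p : ℕ → Prop) [DecidablePred p]

theorem count_outside_Ico_add_count {a b : ℕ} (hab : a ≤ b) (m : ℕ) :
    Nat.count (fun x => (x < a ∨ b ≤ x) ∧ p x) m + Nat.count p (min m b) =
      Nat.count p m + Nat.count p (min m a) := by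
  induction m with
  | zero => simp
  | succ m ih => grind

-- For `b ≤ a` nothing is left out, in accordance with the truncated subtraction.
theorem count_outside_Ico {a b m : ℕ} (hbm : b ≤ m) :
    Nat.count (fun x => (x < a ∨ b ≤ x) ∧ p x) m =
      Nat.count p m - (Nat.count p b - Nat.count p a) := by
  rcases le_total a b with hab | hba
  · have hcount := count_outside_Ico_add_count p hab m
    have hmono : Nat.count p a ≤ Nat.count p b := Nat.count_monotone p hab
    rw [min_eq_right hbm, min_eq_right (hab.trans hbm)] at hcount
    omega
  · rw [Nat.sub_eq_zero_of_le (Nat.count_monotone p hba), Nat.sub_zero]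
    congr! with x
    exact and_iff_right_of_imp fun _ => (lt_or_ge x a).imp_right hba.trans

theorem ncard_setOf_val (m : ℕ) : {v : Fin m | p v}.ncard = Nat.count p m := by
  rw [Nat.count_eq_card_filter_range, ← Set.ncard_image_of_injective _ Fin.val_injective,
    ← Set.ncard_coe_finset]
  congr 1
  ext x
  simp [Fin.exists_iff, and_comm]

end Count

namespace gracefulColouring

variable {n k : ℕ}

theorem get_eq {i j : Fin (n + 1)} (h : i ≠ j) :
    (gracefulColouring n).get i j h = ((i : ℤ) - (j : ℤ)).natAbs := rfl

theorem labelGraph_adj (hk : 0 < k) {i j : Fin (n + 1)} :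
    ((gracefulColouring n).labelGraph k).Adj i j ↔ (i : ℕ) + k = j ∨ (j : ℕ) + k = i := by
  simp only [TopEdgeLabeling.labelGraph_adj, get_eq, exists_prop, ne_eq, Fin.ext_iff]
  omega

theorem mem_range : k ∈ Set.range (gracefulColouring n) ↔ 0 < k ∧ k ≤ n := by
  constructor
  · rintro ⟨⟨e, he⟩, rfl⟩
    induction e with | _ i j
    have hne : i ≠ j := he
    have hcolour : gracefulColouring n ⟨s(i, j), he⟩ = ((i : ℤ) - (j : ℤ)).natAbs := get_eq hne
    rw [hcolour]
    omega
  · rintro ⟨hk, hkn⟩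
    obtain ⟨h, hcolour⟩ := (EdgeLabeling.labelGraph_adj _ _).1
      ((labelGraph_adj hk (i := 0) (j := (⟨k, by omega⟩ : Fin (n + 1)))).2 (by simp))
    exact ⟨_, hcolour⟩

/-- The edge `{j, j + k}`. These are the edges of colour `k`, enumerated by their smaller end. -/
def classEdge (n k : ℕ) (j : Fin (n + 1 - k)) : Sym2 (Fin (n + 1)) :=
  s(⟨j, by omega⟩, ⟨j + k, by omega⟩)

theorem classEdge_injective : Function.Injective (classEdge n k) := by
  intro i j h
  simp only [classEdge, Sym2.eq_iff, Fin.mk.injEq] at h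
  omega

theorem edgeSet_labelGraph (hk : 0 < k) :
    ((gracefulColouring n).labelGraph k).edgeSet = Set.range (classEdge n k) := by
  ext e
  induction e with | _ i j
  simp only [mem_edgeSet, labelGraph_adj hk, Set.mem_range, classEdge, Sym2.eq_iff, Fin.ext_iff,
    Fin.exists_iff]
  constructor
  · rintro (h | h)
    · exact ⟨i, by omega, by omega⟩
    · exact ⟨j, by omega, by omega⟩
  · rintro ⟨l, -, h⟩
    omega

theorem ncard_edges_within (hk : 0 < k) (p : ℕ → Prop) [DecidablePred p] :
    {e ∈ ((gracefulColouring n).labelGraph k).edgeSet |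
      ∀ v ∈ e, v ∈ {v : Fin (n + 1) | p v}}.ncard =
      Nat.count (fun j => p j ∧ p (j + k)) (n + 1 - k) := by
  rw [← ncard_setOf_val, ← Set.ncard_image_of_injective _ classEdge_injective,
    edgeSet_labelGraph hk]
  congr 1
  ext e
  constructor
  · rintro ⟨⟨j, rfl⟩, h⟩
    exact ⟨j, by simpa [classEdge] using h, rfl⟩
  · rintro ⟨j, h, rfl⟩
    exact ⟨⟨j, rfl⟩, by simpa [classEdge] using h⟩

theorem classSize_eq (hk : 0 < k) : (gracefulColouring n).classSize k = n + 1 - k := by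
  simpa [EdgeLabeling.classSize] using ncard_edges_within (n := n) hk fun _ => True

theorem classSize_modEq_iff (hk : 0 < k) (hkn : k ≤ n) :
    (gracefulColouring n).classSize k ≡ n [MOD 2] ↔ Odd k := by
  rw [classSize_eq hk, Nat.odd_iff, Nat.ModEq]
  omega

theorem isNice (n : ℕ) : (gracefulColouring n).IsNice := by
  refine ⟨fun k hk => ?_, fun k hk l hl h => ?_, fun i hi => ?_⟩
  · rw [mem_range] at hk
    rw [classSize_eq hk.1, Set.mem_Icc]
    omega
  · rw [mem_range] at hk hl
    rw [classSize_eq hk.1, classSize_eq hl.1] at h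
    omega
  · rw [Set.mem_Icc] at hi
    refine ⟨n + 1 - i, mem_range.2 (by omega), ?_⟩
    rw [classSize_eq (by omega)]
    omega

theorem isAcyclic_labelGraph (hk : 0 < k) :
    ((gracefulColouring n).labelGraph k).IsAcyclic := by
  -- The truncated subtraction sends the vertices below `k` to `0`, which only adds edges.
  let f (v : Fin (n + 1)) : Fin (n + 1) := ⟨v - k, by omega⟩
  have hle : (gracefulColouring n).labelGraph k ≤ functionalGraph f := by
    intro i j h
    refine functionalGraph.adj_iff.2 ⟨h.ne, ?_⟩
    simp only [labelGraph_adj hk, f, Fin.ext_iff] at h ⊢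
    omega
  refine (functionalGraph.isAcyclic (height := id) fun v hv => ?_).anti hle
  simp only [f, ne_eq, Fin.ext_iff, id_eq, Fin.lt_def] at hv ⊢
  omega

theorem iSup_labelGraph_eq_between (n : ℕ) :
    (⨆ k ∈ {k ∈ Set.range (gracefulColouring n) |
      (gracefulColouring n).classSize k ≡ n [MOD 2]}, (gracefulColouring n).labelGraph k) =
      (⊤ : SimpleGraph (Fin (n + 1))).between
        {v : Fin (n + 1) | Odd (v : ℕ)} {v : Fin (n + 1) | Even (v : ℕ)} := by
  ext i j
  simp only [iSup_adj, between_adj, top_adj, Set.mem_ofPred_eq, exists_prop, Nat.odd_iff,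
    Nat.even_iff]
  constructor
  · rintro ⟨k, ⟨hk, hmod⟩, hadj⟩
    rw [mem_range] at hk
    rw [classSize_modEq_iff hk.1 hk.2, Nat.odd_iff] at hmod
    refine ⟨hadj.ne, ?_⟩
    rw [labelGraph_adj hk.1] at hadj
    omega
  · rintro ⟨-, h⟩
    have hk : 0 < ((i : ℤ) - j).natAbs ∧ ((i : ℤ) - j).natAbs ≤ n := by omega
    refine ⟨((i : ℤ) - j).natAbs, ⟨mem_range.2 hk, ?_⟩, ?_⟩
    · rw [classSize_modEq_iff hk.1 hk.2, Nat.odd_iff]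
      omega
    · rw [labelGraph_adj hk.1]
      omega

theorem support_labelGraph (hk : 0 < k) :
    ((gracefulColouring n).labelGraph k).support =
      {v : Fin (n + 1) | (v : ℕ) < n + 1 - k ∨ k ≤ v} := by
  ext v
  simp only [mem_support, labelGraph_adj hk, Set.mem_ofPred_eq, Fin.exists_iff]
  constructor
  · rintro ⟨w, hwn, hw⟩
    omega
  · rintro (h | h)
    · exact ⟨v + k, by omega, by omega⟩
    · exact ⟨v - k, by omega, by omega⟩

theorem ncard_support_inter (hk : 0 < k) (hkn : k ≤ n) (p : ℕ → Prop) [DecidablePred p] :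
    (((gracefulColouring n).labelGraph k).support ∩ {v | p v}).ncard =
      Nat.count p (n + 1) - (Nat.count p k - Nat.count p (n + 1 - k)) := by
  rw [support_labelGraph hk, ← Set.ofPred_and, ← count_outside_Ico p (by omega)]
  exact ncard_setOf_val (fun v => (v < n + 1 - k ∨ k ≤ v) ∧ p v) (n + 1)

theorem support_balanced (hk : 0 < k) (hkn : k ≤ n) (hodd : Odd k) :
    (((gracefulColouring n).labelGraph k).support ∩ {v | Odd (v : ℕ)}).ncard =
        ((gracefulColouring n).labelGraph k).support.ncard / 2 ∧
      (((gracefulColouring n).labelGraph k).support ∩ {v | Even (v : ℕ)}).ncard =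
        (((gracefulColouring n).labelGraph k).support.ncard + 1) / 2 := by
  have hall := ncard_support_inter hk hkn fun _ => True
  simp only [Set.ofPred_true, Set.inter_univ, Nat.count_true] at hall
  rw [ncard_support_inter hk hkn, ncard_support_inter hk hkn, hall]
  simp only [count_odd, count_even]
  rw [Nat.odd_iff] at hodd
  omega

theorem edges_balanced (hk : 0 < k) (heven : Even k) :
    {e ∈ ((gracefulColouring n).labelGraph k).edgeSet |
        ∀ v ∈ e, v ∈ {v : Fin (n + 1) | Odd (v : ℕ)}}.ncard =
        (gracefulColouring n).classSize k / 2 ∧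
      {e ∈ ((gracefulColouring n).labelGraph k).edgeSet |
        ∀ v ∈ e, v ∈ {v : Fin (n + 1) | Even (v : ℕ)}}.ncard =
        ((gracefulColouring n).classSize k + 1) / 2 := by
  rw [ncard_edges_within hk, ncard_edges_within hk, classSize_eq hk, ← count_odd, ← count_even]
  simp only [Nat.odd_add, Nat.even_add, heven, iff_true, and_self]

theorem isBeautiful (n : ℕ) : (gracefulColouring n).IsBeautiful where
  nice := isNice n
  acyclic k hk := isAcyclic_labelGraph (mem_range.1 hk).1
  exists_partition := by
    refine ⟨{v | Odd (v : ℕ)}, {v | Even (v : ℕ)}, ?_, ?_, ?_, iSup_labelGraph_eq_between n,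
      fun k hk hmod => ?_, fun k hk hmod => ?_⟩
    · rw [← compl_eq_iff_isCompl]
      ext v
      simp
    · rw [ncard_setOf_val, count_odd]
    · rw [ncard_setOf_val, count_even]
    · obtain ⟨hk, hkn⟩ := mem_range.1 hk
      exact support_balanced hk hkn ((classSize_modEq_iff hk hkn).1 hmod)
    · obtain ⟨hk, hkn⟩ := mem_range.1 hk
      exact edges_balanced hk
        (Nat.not_odd_iff_even.1 (mt (classSize_modEq_iff hk hkn).2 hmod))

end gracefulColouring

section DoubleStar

variable {n : ℕ} {A : Finset (Fin (n + 1))}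

/-- The double star on `{0, …, n}` with centres `0` and `n`: the vertices in `A` are leaves at `n`,
all others are joined to `0`. It is meant for sets `A` of inner vertices. -/
def doubleStar (A : Finset (Fin (n + 1))) : SimpleGraph (Fin (n + 1)) :=
  functionalGraph fun v => if v ∈ A then Fin.last n else 0

/-- The sets of inner vertices of `{0, …, n}` that are invariant under `v ↦ n - v`. That `n` is not
an element follows from the invariance. -/
def symmetricInnerSets (n : ℕ) : Set (Finset (Fin (n + 1))) :=
  {A | 0 ∉ A ∧ ∀ v ∈ A, v.rev ∈ A}

theorem last_notMem_of_mem_symmetricInnerSets (hA : A ∈ symmetricInnerSets n) :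
    Fin.last n ∉ A :=
  fun h => hA.1 (Fin.rev_last n ▸ hA.2 _ h)

theorem isTree_doubleStar (h0 : 0 ∉ A) (hlast : Fin.last n ∉ A) : (doubleStar A).IsTree := by
  let height (v : Fin (n + 1)) : ℕ := if v = 0 then 0 else if v ∈ A then 2 else 1
  exact functionalGraph.isTree (height := height) (root := 0) (by grind) (by grind)

theorem isHeterochromatic_doubleStar (hA : ∀ v ∈ A, v.rev ∈ A) :
    (gracefulColouring n).IsHeterochromatic (doubleStar A) := by
  let reflect (v : Fin (n + 1)) : Fin (n + 1) := if v ∈ A then v.rev else v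
  have reflect_involutive : Function.Involutive reflect := by
    intro v
    by_cases hv : v ∈ A <;> simp [reflect, hv, hA]
  have colour_eq (v) (hne : v ≠ if v ∈ A then Fin.last n else 0) :
      (gracefulColouring n).get v (if v ∈ A then Fin.last n else 0) hne = reflect v := by
    rw [gracefulColouring.get_eq]
    by_cases hv : v ∈ A
    · simp only [hv, if_true, reflect, Fin.val_last, Fin.val_rev]
      omega
    · simp [hv, reflect]
  refine functionalGraph.isHeterochromatic fun v w hv hw h => ?_
  rw [colour_eq, colour_eq] at h
  exact reflect_involutive.injective (Fin.ext h)

theorem mem_iff_doubleStar_adj_last {v : Fin (n + 1)} (h0 : 0 ∉ A) (hlast : Fin.last n ∉ A) :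
    v ∈ A ↔ v ≠ 0 ∧ (doubleStar A).Adj v (Fin.last n) := by
  rw [doubleStar, functionalGraph.adj_iff]
  grind

theorem doubleStar_injOn : Set.InjOn doubleStar (symmetricInnerSets n) := by
  intro A hA B hB hAB
  ext v
  rw [mem_iff_doubleStar_adj_last hA.1 (last_notMem_of_mem_symmetricInnerSets hA),
    mem_iff_doubleStar_adj_last hB.1 (last_notMem_of_mem_symmetricInnerSets hB), hAB]

theorem two_pow_le_ncard_symmetricInnerSets (n : ℕ) :
    2 ^ (n / 2) ≤ (symmetricInnerSets n).ncard := by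
  -- The smaller elements of the orbits of `v ↦ n - v` on the inner vertices.
  let lowerHalf : Finset (Fin (n + 1)) := Finset.Ioc 0 ⟨n / 2, by omega⟩
  let symmetrize (S : Finset (Fin (n + 1))) : Finset (Fin (n + 1)) := {v | min v v.rev ∈ S}
  have mem_symmetrize {S} {v : Fin (n + 1)} (hv : v ∈ lowerHalf) : v ∈ symmetrize S ↔ v ∈ S := by
    have hle : v ≤ v.rev := by
      simp only [lowerHalf, Finset.mem_Ioc, Fin.le_def, Fin.val_rev] at hv ⊢
      omega
    simp [symmetrize, min_eq_left hle]
  have hcard : (lowerHalf.powerset : Set (Finset (Fin (n + 1)))).ncard = 2 ^ (n / 2) := by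
    rw [Set.ncard_coe_finset, Finset.card_powerset, Fin.card_Ioc, Fin.val_zero, Nat.sub_zero]
  rw [← hcard]
  refine Set.ncard_le_ncard_of_injOn symmetrize (fun S hS => ⟨?_, ?_⟩) (fun S hS T hT hST => ?_)
    (Set.toFinite _)
  · have h0 : 0 ∉ S := fun h => by simpa [lowerHalf] using Finset.mem_powerset.1 hS h
    simpa [symmetrize] using h0
  · simp [symmetrize, min_comm]
  · ext v
    by_cases hv : v ∈ lowerHalf
    · rw [← mem_symmetrize hv, hST, mem_symmetrize hv]
    · exact iff_of_false (fun h => hv (Finset.mem_powerset.1 hS h))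
        fun h => hv (Finset.mem_powerset.1 hT h)

theorem two_pow_le_ncard_heterochromaticSpanningTrees (n : ℕ) :
    2 ^ (n / 2) ≤ (gracefulColouring n).heterochromaticSpanningTrees.ncard :=
  (two_pow_le_ncard_symmetricInnerSets n).trans <|
    Set.ncard_le_ncard_of_injOn doubleStar
      (fun _ hA => ⟨le_top,
        isTree_doubleStar hA.1 (last_notMem_of_mem_symmetricInnerSets hA),
        isHeterochromatic_doubleStar hA.2⟩)
      doubleStar_injOn (Set.toFinite _)

end DoubleStar

theorem corollary4_general (n : ℕ) :
    (gracefulColouring n).IsBeautiful ∧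
      2 ^ (n / 2) ≤ (gracefulColouring n).heterochromaticSpanningTrees.ncard :=
  ⟨gracefulColouring.isBeautiful n, two_pow_le_ncard_heterochromaticSpanningTrees n⟩

theorem corollary4 (n : ℕ) (hn : 2 ≤ n) :
    (gracefulColouring n).IsBeautiful ∧
      2 ^ ((n - 1) / 2) ≤ (gracefulColouring n).heterochromaticSpanningTrees.ncard := by
  obtain ⟨hbeautiful, htrees⟩ := corollary4_general n
  exact ⟨hbeautiful, (Nat.pow_le_pow_right two_pos (by omega)).trans htrees⟩
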